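/- Setting. Let $\mathrm{R}$ be a spherical (finite, not necessarily crystallographic) root system in a real vector space $V$, with basis $B$, rank $n=|B|=\dim_{\mathbb R}V$ and spherical Weyl group $W_s$, and let $F\subseteq\mathbb{R}$ be a subfield containing all $\langle\beta,\alpha^\vee\rangle$, $\alpha,\beta\in \mathrm{R}$. For a non-trivial totally ordered abelian group $\Lambda$ with an $F$-module structure put $\mathbb{M}(\mathrm{R},\Lambda)=\mathrm{span}_F(\mathrm{R})\otimes_F\Lambda\ (\cong\Lambda^n$ via $B)$, with the distance $d(x,y)=\sum_{\alpha\in \mathrm{R}^+}|\langle y-x,\alpha^\vee\rangle|$, and let $W(\Lambda)=W_s\ltimes \mathbb{M}(\mathrm{R},\Lambda)\cong W_s\ltimes\Lambda^n$ be the full affine Weyl group, acting on $\mathbb{M}(\mathrm{R},\Lambda)$. Weyl chambers are the $W(\Lambda)$-images of $\{x:\langle x,\alpha^\vee\rangle\ge 0\ \forall\alpha\in \mathrm{R}^+\}$, half-apartments are the $W(\Lambda)$-images of the sets $\{x:\langle x,\alpha^\vee\rangle\ge 0\}$, $\alpha\in \mathrm{R}$, and convex sets are the finite intersections of half-apartments.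 A set $X$ with a set $\mathcal{A}$ of injective maps (charts) $f:\mathbb{M}(\mathrm{R},\Lambda)\to X$ is a generalized affine building modeled on $\mathbb{M}=\mathbb{M}(\mathrm{R},\Lambda)$ if the following hold, where apartments are the images of charts, and Weyl chambers and half-apartments of $X$ are images under charts of those of $\mathbb{M}$. (A1) $f\circ w\in\mathcal{A}$ for $f\in\mathcal{A}$, $w\in W(\Lambda)$. (A2) If $f,g\in\mathcal{A}$ and $f(\mathbb{M})\cap g(\mathbb{M})\ne\emptyset$, then $f^{-1}(g(\mathbb{M}))$ is convex and there is $w\in W(\Lambda)$ with $f=g\circ w$ on this set. (A3) Any two points of $X$ lie in a common apartment. (A4) Any two Weyl chambers of $X$ contain Weyl chambers of $X$ which lie in a common apartment. (A5) For every apartment $A$ and $x\in A$ there is a retraction $r:X\to A$ which does not increase distances and satisfies $r^{-1}(x)=\{x\}$. (A6) If the apartments of three charts intersect pairwise in half-apartments, then the three apartments have a common point. Here the distance on $X$ is $d(f(a),f(b))=d(a,b)$ for $f\in\mathcal{A}$ and $a,b\in\mathbb{M}$. Statement. Let $\mu$ be an ultrafilter on a set $I$ and, for each $i\in I$, let $(X_i,\mathcal{A}_i)$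 be a generalized affine building modeled on $\mathbb{M}(\mathrm{R},\Lambda_i)$, where $\Lambda_i$ is a non-trivial totally ordered abelian group with an $F$-module structure, and let $d_i$ be its distance. For sets $Y_i$ let $\prod_\mu Y_i$ be the set of classes $[y_i]$ of sequences $(y_i)_{i\in I}\in\prod_i Y_i$ modulo equality on a set of measure one; let $\prod_\mu\Lambda_i$ carry the componentwise operations and the order $[a_i]\le[b_i]\iff\mu(\{i:a_i\le b_i\})=1$. Then the following hold. 1. The canonical $F$-linear map $\mathbb{M}(\mathrm{R},\prod_\mu\Lambda_i)\to\prod_\mu\mathbb{M}(\mathrm{R},\Lambda_i)$, $v\otimes[\lambda_i]\mapsto[v\otimes\lambda_i]$, is bijective. 2. Identify these two spaces, and let $\prod_\mu\mathcal{A}_i$ be the set of maps $[x_i]\mapsto[f_i(x_i)]$ with $f_i\in\mathcal{A}_i$ for all $i$. Then $(\prod_\mu X_i,\prod_\mu\mathcal{A}_i)$ is a generalized affine building modeled on $\mathbb{M}(\mathrm{R},\prod_\mu\Lambda_i)$. 3. The distance on this building is the ultraproduct $([x_i],[y_i])\mapsto[d_i(x_i,y_i)]$ of the distances $d_i$, and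 it is a $\prod_\mu\Lambda_i$-valued metric. More generally, for arbitrary $\Lambda_i$-valued metrics $d_i'$ on $X_i$, $([x_i],[y_i])\mapsto[d_i'(x_i,y_i)]$ is a $\prod_\mu\Lambda_i$-valued metric on $\prod_\mu X_i$. 4. There is a group isomorphism $\prod_\mu W(\Lambda_i)\cong W(\prod_\mu\Lambda_i)$ which sends $[(u,t_i)]$ to $(u,[t_i])$ for $u\in W_s$ and $t_i\in\mathbb{M}(\mathrm{R},\Lambda_i)$, and which is compatible with the actions on $\prod_\mu\mathbb{M}(\mathrm{R},\Lambda_i)\cong\mathbb{M}(\mathrm{R},\prod_\mu\Lambda_i)$. In the coordinates given by $B$ there is a group isomorphism $\prod_\mu W(\Lambda_i)\cong W_s\ltimes(\prod_\mu\Lambda_i)^n$ sending $[(u,t_i)]$ to $(u,[t_i])$. -/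

import Mathlib

open scoped TensorProduct

namespace LambdaBuilding

/-! ## Ultraproducts -/

section Ultraproduct

variable {I : Type*} (μ : Ultrafilter I)

/-- The ultraproduct of a family of types: the cartesian product modulo equality on a set of
measure one. -/
def UProd (X : I → Type*) : Type _ := (μ : Filter I).Product X

namespace UProd

variable {μ} {X Y Z : I → Type*}

variable (μ) in
/-- The class of a sequence. -/
def mk (x : ∀ i, X i) : UProd μ X := Quotient.mk ((μ : Filter I).productSetoid X) x

theorem mk_surjective : Function.Surjective (mk μ : (∀ i, X i) → UProd μ X) :=
  Quotient.mk_surjective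

theorem mk_eq_mk {x y : ∀ i, X i} : mk μ x = mk μ y ↔ ∀ᶠ i in (μ : Filter I), x i = y i :=
  Quotient.eq (r := (μ : Filter I).productSetoid X)

/-- The map of ultraproducts induced by a sequence of maps. -/
def map (f : ∀ i, X i → Y i) : UProd μ X → UProd μ Y :=
  Quotient.lift (fun x => mk μ (fun i => f i (x i)))
    (fun _ _ h => mk_eq_mk.2 (Filter.Eventually.mono h fun i hi => by rw [hi]))

/-- The binary map of ultraproducts induced by a sequence of binary maps. -/
def map₂ (f : ∀ i, X i → Y i → Z i) : UProd μ X → UProd μ Y → UProd μ Z :=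
  Quotient.lift₂ (fun x y => mk μ (fun i => f i (x i) (y i)))
    (fun _ _ _ _ h h' => mk_eq_mk.2 (by
      filter_upwards [h, h'] with i hi hi'
      rw [hi, hi']))

theorem map_mk (f : ∀ i, X i → Y i) (x : ∀ i, X i) :
    map f (mk μ x) = mk μ (fun i => f i (x i)) := rfl

theorem map₂_mk (f : ∀ i, X i → Y i → Z i) (x : ∀ i, X i) (y : ∀ i, Y i) :
    map₂ f (mk μ x) (mk μ y) = mk μ (fun i => f i (x i) (y i)) := rfl

instance [∀ i, Zero (X i)] : Zero (UProd μ X) := ⟨mk μ fun _ => 0⟩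
instance [∀ i, Add (X i)] : Add (UProd μ X) := ⟨map₂ fun _ a b => a + b⟩
instance [∀ i, Neg (X i)] : Neg (UProd μ X) := ⟨map fun _ a => -a⟩
instance [∀ i, Sub (X i)] : Sub (UProd μ X) := ⟨map₂ fun _ a b => a - b⟩
instance {S : Type*} [∀ i, SMul S (X i)] : SMul S (UProd μ X) := ⟨fun s => map fun _ a => s • a⟩
instance [∀ i, One (X i)] : One (UProd μ X) := ⟨mk μ fun _ => 1⟩
instance [∀ i, Mul (X i)] : Mul (UProd μ X) := ⟨map₂ fun _ a b => a * b⟩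
instance [∀ i, Inv (X i)] : Inv (UProd μ X) := ⟨map fun _ a => a⁻¹⟩
instance [∀ i, Div (X i)] : Div (UProd μ X) := ⟨map₂ fun _ a b => a / b⟩
instance {S : Type*} [∀ i, Pow (X i) S] : Pow (UProd μ X) S := ⟨fun x s => map (fun _ a => a ^ s) x⟩

instance [∀ i, AddCommGroup (X i)] : AddCommGroup (UProd μ X) :=
  Function.Surjective.addCommGroup (mk μ) mk_surjective rfl (fun _ _ => rfl) (fun _ => rfl)
    (fun _ _ => rfl) (fun _ _ => rfl) (fun _ _ => rfl)

instance [∀ i, Group (X i)] : Group (UProd μ X) :=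
  Function.Surjective.group (mk μ) mk_surjective rfl (fun _ _ => rfl) (fun _ => rfl)
    (fun _ _ => rfl) (fun _ _ => rfl) (fun _ _ => rfl)

instance instModule {S : Type*} [Semiring S] [∀ i, AddCommGroup (X i)] [∀ i, Module S (X i)] :
    Module S (UProd μ X) :=
  Function.Surjective.module S
    ({ toFun := mk μ, map_zero' := rfl, map_add' := fun _ _ => rfl } : (∀ i, X i) →+ UProd μ X)
    mk_surjective (fun _ _ => rfl)

/-- `[a] ≤ [b]` if and only if `a i ≤ b i` on a set of measure one. -/
instance [∀ i, LE (X i)] : LE (UProd μ X) :=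
  ⟨Quotient.lift₂ (fun a b => ∀ᶠ i in (μ : Filter I), a i ≤ b i) (fun _ _ _ _ h h' => by
    refine propext (Filter.eventually_congr ?_)
    filter_upwards [h, h'] with i hi hi'
    rw [hi, hi'])⟩

theorem mk_le_mk [∀ i, LE (X i)] {a b : ∀ i, X i} :
    mk μ a ≤ mk μ b ↔ ∀ᶠ i in (μ : Filter I), a i ≤ b i := Iff.rfl

noncomputable instance [∀ i, LinearOrder (X i)] : LinearOrder (UProd μ X) where
  le_refl a := by
    obtain ⟨a, rfl⟩ := mk_surjective a
    exact mk_le_mk.2 (Filter.Eventually.of_forall fun _ => le_rfl)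
  le_trans a b c := by
    obtain ⟨a, rfl⟩ := mk_surjective a
    obtain ⟨b, rfl⟩ := mk_surjective b
    obtain ⟨c, rfl⟩ := mk_surjective c
    simp only [mk_le_mk]
    intro h h'
    filter_upwards [h, h'] with i hi hi' using hi.trans hi'
  le_antisymm a b := by
    obtain ⟨a, rfl⟩ := mk_surjective a
    obtain ⟨b, rfl⟩ := mk_surjective b
    simp only [mk_le_mk, mk_eq_mk]
    intro h h'
    filter_upwards [h, h'] with i hi hi' using le_antisymm hi hi'
  le_total a b := by
    obtain ⟨a, rfl⟩ := mk_surjective a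
    obtain ⟨b, rfl⟩ := mk_surjective b
    simp only [mk_le_mk]
    rw [← Ultrafilter.eventually_or]
    exact Filter.Eventually.of_forall fun i => le_total (a i) (b i)
  toDecidableLE := Classical.decRel _

instance [∀ i, AddCommGroup (X i)] [∀ i, LinearOrder (X i)] [∀ i, IsOrderedAddMonoid (X i)] :
    IsOrderedAddMonoid (UProd μ X) where
  add_le_add_left a b := by
    obtain ⟨a, rfl⟩ := mk_surjective a
    obtain ⟨b, rfl⟩ := mk_surjective b
    intro h c
    obtain ⟨c, rfl⟩ := mk_surjective c
    exact Filter.Eventually.mono (mk_le_mk.1 h) fun i hi => add_le_add_left hi (c i)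

instance [∀ i, Nontrivial (X i)] : Nontrivial (UProd μ X) := by
  choose x y h using fun i => exists_pair_ne (X i)
  refine ⟨mk μ x, mk μ y, fun he => ?_⟩
  obtain ⟨i, hi⟩ := (mk_eq_mk.1 he).exists
  exact h i hi

/-- If every factor is an ordered module then so is the ultraproduct. -/
instance {S : Type*} [Semiring S] [PartialOrder S] [∀ i, AddCommGroup (X i)]
    [∀ i, LinearOrder (X i)] [∀ i, Module S (X i)] [∀ i, IsOrderedModule S (X i)] :
    IsOrderedModule S (UProd μ X) where
  smul_le_smul_of_nonneg_left s hs a b := by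
    obtain ⟨a, rfl⟩ := mk_surjective a
    obtain ⟨b, rfl⟩ := mk_surjective b
    intro h
    exact Filter.Eventually.mono (mk_le_mk.1 h) fun i hi => smul_le_smul_of_nonneg_left hi hs
  smul_le_smul_of_nonneg_right a ha s t hst := by
    obtain ⟨a, rfl⟩ := mk_surjective a
    exact Filter.Eventually.mono (mk_le_mk.1 ha) fun i hi => smul_le_smul_of_nonneg_right hst hi

end UProd

end Ultraproduct

/-! ## Metrics with values in an ordered abelian group -/

/-- The axioms of a metric with values in a totally ordered abelian group `Λ`. -/
structure IsLambdaMetric {X Λ : Type*} [AddCommGroup Λ] [LinearOrder Λ] (d : X → X → Λ) :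
    Prop where
  nonneg : ∀ x y, 0 ≤ d x y
  eq_zero_iff : ∀ x y, d x y = 0 ↔ x = y
  symm : ∀ x y, d x y = d y x
  triangle : ∀ x y z, d x z ≤ d x y + d y z

/-- The ultraproduct of a sequence of distance functions. -/
def uDist {I : Type*} (μ : Ultrafilter I) {X Λ : I → Type*} (d : ∀ i, X i → X i → Λ i) :
    UProd μ X → UProd μ X → UProd μ Λ :=
  UProd.map₂ d

noncomputable section Model

/-! ## The model space of a (not necessarily crystallographic) finite root system -/

variable {ι V N : Type*} [Fintype ι] [AddCommGroup V] [Module ℝ V] [AddCommGroup N] [Module ℝ N]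
variable (P : RootPairing ι ℝ V N) [P.IsRootSystem]

/-- A basis of a root system: a linearly independent set of roots such that every root is a linear
combination of it with all coefficients nonnegative or all coefficients nonpositive (for
non-crystallographic root systems the coefficients are real numbers). -/
structure SimpleRoots where
  /-- the indices of the simple roots -/
  support : Finset ι
  linearIndepOn : LinearIndepOn ℝ P.root support
  root_mem_cone : ∀ i, ∃ c : ι → ℝ, (∀ j, 0 ≤ c j) ∧
    (P.root i = ∑ j ∈ support, c j • P.root j ∨ P.root i = -∑ j ∈ support, c j • P.root j)

variable {P} in
/-- The positive roots determined by a basis. -/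
def SimpleRoots.IsPos (B : SimpleRoots P) (i : ι) : Prop :=
  ∃ c : ι → ℝ, (∀ j, 0 ≤ c j) ∧ P.root i = ∑ j ∈ B.support, c j • P.root j

variable (F : Subfield ℝ) [P.IsValuedIn F]

variable {P} in
/-- A basis of the root system is an `F`-basis of the `F`-span of the roots. -/
def SimpleRoots.basis (B : SimpleRoots P) : Module.Basis B.support F (P.rootSpan F) := by
  have hli : LinearIndependent F (fun j : B.support => P.rootSpanMem F j) :=
    LinearIndependent.of_comp (P.rootSpan F).subtype
      (LinearIndependent.restrict_scalars' (R := F) (K := ℝ) B.linearIndepOn)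
  refine Module.Basis.mk hli (hli.span_eq_top_of_card_eq_finrank' ?_).ge
  have hspan : Submodule.span ℝ (Set.range fun j : B.support => P.root j) = ⊤ := by
    rw [eq_top_iff, ← RootPairing.IsRootSystem.span_root_eq_top (P := P), Submodule.span_le]
    rintro _ ⟨i, rfl⟩
    obtain ⟨c, -, hc⟩ := B.root_mem_cone i
    have hs : ∑ j ∈ B.support, c j • P.root j ∈
        Submodule.span ℝ (Set.range fun j : B.support => P.root j) :=
      Submodule.sum_mem _ fun j hj =>
        Submodule.smul_mem _ _ (Submodule.subset_span ⟨⟨j, hj⟩, rfl⟩)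
    rcases hc with hc | hc
    · exact hc ▸ hs
    · exact hc ▸ Submodule.neg_mem _ hs
  rw [P.finrank_rootSpanIn F]
  exact (Module.finrank_eq_card_basis (Module.Basis.mk B.linearIndepOn hspan.ge)).symm

/-- The action of the spherical Weyl group on the `F`-span of the roots. -/
def weylSpan : Representation F P.weylGroup (P.rootSpan F) where
  toFun w := ((P.weylGroupRootRep w).restrictScalars F).restrict (p := P.rootSpan F)
    (q := P.rootSpan F) (fun x hx => by
      induction hx using Submodule.span_induction with
      | mem x hx =>
        obtain ⟨i, rfl⟩ := hx
        change w • P.root i ∈ _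
        rw [P.weylGroup_apply_root]
        exact Submodule.subset_span ⟨_, rfl⟩
      | zero => simp
      | add x y _ _ hx hy => rw [map_add]; exact Submodule.add_mem _ hx hy
      | smul a x _ hx => rw [map_smul]; exact Submodule.smul_mem _ a hx)
  map_one' := by ext x; simp
  map_mul' v w := by ext x; simp

variable (Λ : Type*) [AddCommGroup Λ] [Module F Λ]

/-- The model space `𝕄(R, Λ) = span_F(R) ⊗_F Λ`. -/
def ModelSpace : Type _ := P.rootSpan F ⊗[F] Λ

instance : AddCommGroup (ModelSpace P F Λ) :=
  TensorProduct.addCommGroup (R := F) (M := P.rootSpan F) (N := Λ)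

instance : Module F (ModelSpace P F Λ) :=
  TensorProduct.instModule (R := F) (M := P.rootSpan F) (N := Λ)

variable {P F Λ} in
/-- The element `v ⊗ l` of the model space. -/
def ModelSpace.tmul (v : P.rootSpan F) (l : Λ) : ModelSpace P F Λ := v ⊗ₜ[F] l

/-- The model space is the tensor product by definition. -/
def ModelSpace.equivTensor : ModelSpace P F Λ ≃ₗ[F] P.rootSpan F ⊗[F] Λ :=
  LinearEquiv.refl F (P.rootSpan F ⊗[F] Λ)

/-- The evaluation `x ↦ ⟨x, α^∨⟩ ∈ Λ` of the coroot with index `i`, extended linearly to the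
model space. -/
def corootEval (i : ι) : ModelSpace P F Λ →ₗ[F] Λ :=
  (TensorProduct.lid F Λ).toLinearMap ∘ₗ (P.coroot'In F i).rTensor Λ ∘ₗ
    (ModelSpace.equivTensor P F Λ).toLinearMap

/-- The action of the spherical Weyl group on the model space. -/
def weylModel : Representation F P.weylGroup (ModelSpace P F Λ) where
  toFun w := (ModelSpace.equivTensor P F Λ).symm.toLinearMap ∘ₗ (weylSpan P F w).rTensor Λ ∘ₗ
    (ModelSpace.equivTensor P F Λ).toLinearMap
  map_one' := by
    rw [map_one]
    exact LinearMap.rTensor_id (R := F) Λ (P.rootSpan F)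
  map_mul' v w := by
    rw [map_mul]
    exact LinearMap.rTensor_mul Λ (weylSpan P F v) (weylSpan P F w)

open Classical in
/-- The canonical coordinates `𝕄(R, Λ) ≃ Λⁿ` given by a basis of the root system. -/
def coords (B : SimpleRoots P) : ModelSpace P F Λ ≃ₗ[F] (B.support → Λ) :=
  ModelSpace.equivTensor P F Λ ≪≫ₗ TensorProduct.equivFinsuppOfBasisLeft (B.basis F) ≪≫ₗ
    Finsupp.linearEquivFunOnFinite F Λ B.support

/-- A representation on a module gives an action by automorphisms on the additive group
(written multiplicatively). -/
def repAut {G M : Type*} [Group G] [AddCommGroup M] [Module F M] (ρ : Representation F G M) :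
    G →* MulAut (Multiplicative M) where
  toFun g := AddEquiv.toMultiplicative
    { toFun := ρ g
      invFun := ρ g⁻¹
      left_inv := fun x => by simp
      right_inv := fun x => by simp
      map_add' := map_add (ρ g) }
  map_one' := by ext x; simp
  map_mul' g h := by ext x; simp

/-- The full affine Weyl group: the semidirect product of the group of all translations of the
model space by the spherical Weyl group. -/
abbrev AffineWeyl : Type _ :=
  Multiplicative (ModelSpace P F Λ) ⋊[repAut F (weylModel P F Λ)] P.weylGroup

variable {P F Λ} in
/-- The element "first `u`, then translate by `t`" of the full affine Weyl group. -/
def AffineWeyl.mk' (t : ModelSpace P F Λ) (u : P.weylGroup) : AffineWeyl P F Λ :=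
  ⟨Multiplicative.ofAdd t, u⟩

variable {P F Λ} in
/-- The action of the full affine Weyl group on the model space. -/
def AffineWeyl.act (w : AffineWeyl P F Λ) (x : ModelSpace P F Λ) : ModelSpace P F Λ :=
  w.left.toAdd + weylModel P F Λ w.right x

/-- The spherical Weyl group acting on `Λⁿ` through the coordinates of a basis. -/
def weylCoords (B : SimpleRoots P) : Representation F P.weylGroup (B.support → Λ) where
  toFun w := (coords P F Λ B).toLinearMap ∘ₗ weylModel P F Λ w ∘ₗ (coords P F Λ B).symm.toLinearMap
  map_one' := by ext x; simp
  map_mul' v w := by ext x; simp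

/-- The group `W_s ⋉ Λⁿ`. -/
abbrev CoordAffineWeyl (B : SimpleRoots P) : Type _ :=
  Multiplicative (B.support → Λ) ⋊[repAut F (weylCoords P F Λ B)] P.weylGroup

section Ordered

variable {P F Λ}
variable [LinearOrder Λ]

/-- The fundamental Weyl chamber. -/
def fundamentalChamber (B : SimpleRoots P) : Set (ModelSpace P F Λ) :=
  {x | ∀ i, B.IsPos i → 0 ≤ corootEval P F Λ i x}

open Classical in
/-- The distance `d(x, y) = ∑_{α > 0} |⟨y - x, α^∨⟩|` on the model space. -/
def modelDist (B : SimpleRoots P) (x y : ModelSpace P F Λ) : Λ :=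
  ∑ i with B.IsPos i, |corootEval P F Λ i (y - x)|

/-- A half-apartment of the model space: an image under the full affine Weyl group of one of the
sides `{x | 0 ≤ ⟨x, α^∨⟩}` of the hyperplane of a root `α` (the other side belongs to `-α`). -/
def IsHalfApartment (H : Set (ModelSpace P F Λ)) : Prop :=
  ∃ (w : AffineWeyl P F Λ) (i : ι), H = w.act '' {x | 0 ≤ corootEval P F Λ i x}

/-- A subset of the model space is convex if it is a finite intersection of half-apartments
(the empty intersection being the model space). -/
def IsConvex (Y : Set (ModelSpace P F Λ)) : Prop :=
  ∃ 𝓗 : Set (Set (ModelSpace P F Λ)), 𝓗.Finite ∧ (∀ H ∈ 𝓗, IsHalfApartment H) ∧ Y = ⋂₀ 𝓗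

/-! ## Generalized affine buildings -/

variable {X : Type*}

/-- A Weyl chamber of `X`: an image of a Weyl chamber of the model space under a chart. -/
def IsWeylChamberIn (B : SimpleRoots P) (A : Set (ModelSpace P F Λ → X)) (S : Set X) : Prop :=
  ∃ f ∈ A, ∃ w : AffineWeyl P F Λ, S = f '' (w.act '' fundamentalChamber B)

/-- A half-apartment of `X`: an image of a half-apartment of the model space under a chart. -/
def IsHalfApartmentIn (A : Set (ModelSpace P F Λ → X)) (S : Set X) : Prop :=
  ∃ f ∈ A, ∃ H : Set (ModelSpace P F Λ), IsHalfApartment H ∧ S = f '' H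

/-- `l` is the distance, computed in some chart, of the points `x` and `y`. -/
def HasChartDist (B : SimpleRoots P) (A : Set (ModelSpace P F Λ → X)) (x y : X) (l : Λ) : Prop :=
  ∃ f ∈ A, ∃ a b, f a = x ∧ f b = y ∧ l = modelDist B a b

open Classical in
/-- The distance function on `X` induced by the atlas `A` and the distance on the model space
(by the axioms of a building it exists and does not depend on the chosen chart). -/
def chartDist (B : SimpleRoots P) (A : Set (ModelSpace P F Λ → X)) (x y : X) : Λ :=
  if h : ∃ l, HasChartDist B A x y l then h.choose else 0

/-- `X` with the atlas `A` is a generalized affine building modeled on `𝕄(R, Λ)`, equipped with its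
full affine Weyl group. -/
structure IsAffineBuilding [IsOrderedAddMonoid Λ] [Nontrivial Λ]
    (B : SimpleRoots P) (A : Set (ModelSpace P F Λ → X)) : Prop where
  injective : ∀ f ∈ A, Function.Injective f
  A1 : ∀ f ∈ A, ∀ w : AffineWeyl P F Λ, f ∘ w.act ∈ A
  A2 : ∀ f ∈ A, ∀ g ∈ A, (Set.range f ∩ Set.range g).Nonempty →
    IsConvex (f ⁻¹' Set.range g) ∧
      ∃ w : AffineWeyl P F Λ, ∀ x ∈ f ⁻¹' Set.range g, f x = g (w.act x)
  A3 : ∀ x y : X, ∃ f ∈ A, x ∈ Set.range f ∧ y ∈ Set.range f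
  A4 : ∀ S₁ S₂, IsWeylChamberIn B A S₁ → IsWeylChamberIn B A S₂ →
    ∃ S₁' S₂', IsWeylChamberIn B A S₁' ∧ IsWeylChamberIn B A S₂' ∧ S₁' ⊆ S₁ ∧ S₂' ⊆ S₂ ∧
      ∃ f ∈ A, S₁' ∪ S₂' ⊆ Set.range f
  A5 : ∀ f ∈ A, ∀ x ∈ Set.range f, ∃ r : X → X,
    (∀ y, r y ∈ Set.range f) ∧ (∀ y ∈ Set.range f, r y = y) ∧
    (∀ y z, chartDist B A (r y) (r z) ≤ chartDist B A y z) ∧ r ⁻¹' {x} = {x}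
  A6 : ∀ f ∈ A, ∀ g ∈ A, ∀ h ∈ A, IsHalfApartmentIn A (Set.range f ∩ Set.range g) →
    IsHalfApartmentIn A (Set.range g ∩ Set.range h) →
    IsHalfApartmentIn A (Set.range f ∩ Set.range h) →
    (Set.range f ∩ Set.range g ∩ Set.range h).Nonempty

end Ordered

/-! ## Ultraproducts of model spaces and of atlases -/

section UltraModel

variable {I : Type*} (μ : Ultrafilter I) (L : I → Type*) [∀ i, AddCommGroup (L i)]
  [∀ i, Module F (L i)]

/-- The canonical map `v ⊗ [λ] ↦ [v ⊗ λ]` from `𝕄(R, ∏_μ Λᵢ)` to the ultraproduct of the model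
spaces `𝕄(R, Λᵢ)`. -/
def modelToUProd :
    ModelSpace P F (UProd μ L) →ₗ[F] UProd μ (fun i => ModelSpace P F (L i)) :=
  TensorProduct.lift (LinearMap.mk₂ F
    (fun (v : P.rootSpan F) (l : UProd μ L) =>
      UProd.map (fun i a => (ModelSpace.tmul v a : ModelSpace P F (L i))) l)
    (fun v v' l => by
      obtain ⟨l, rfl⟩ := UProd.mk_surjective l
      exact congrArg (UProd.mk μ) (funext fun i => TensorProduct.add_tmul v v' (l i)))
    (fun c v l => by
      obtain ⟨l, rfl⟩ := UProd.mk_surjective l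
      exact congrArg (UProd.mk μ) (funext fun i => (TensorProduct.smul_tmul' c v (l i)).symm))
    (fun v l l' => by
      obtain ⟨l, rfl⟩ := UProd.mk_surjective l
      obtain ⟨l', rfl⟩ := UProd.mk_surjective l'
      exact congrArg (UProd.mk μ) (funext fun i => TensorProduct.tmul_add v (l i) (l' i)))
    (fun c v l => by
      obtain ⟨l, rfl⟩ := UProd.mk_surjective l
      exact congrArg (UProd.mk μ) (funext fun i => TensorProduct.tmul_smul c v (l i)))) ∘ₗ
  (ModelSpace.equivTensor P F (UProd μ L)).toLinearMap

variable {P F L}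
variable {X : I → Type*}

/-- The ultraproduct of a sequence of maps `fᵢ : 𝕄(R, Λᵢ) → Xᵢ`, as a map on `𝕄(R, ∏_μ Λᵢ)`. -/
def uChart (f : ∀ i, ModelSpace P F (L i) → X i) : ModelSpace P F (UProd μ L) → UProd μ X :=
  fun a => UProd.map f (modelToUProd P F μ L a)

/-- The ultraproduct of a sequence of atlases. -/
def uAtlas (A : ∀ i, Set (ModelSpace P F (L i) → X i)) :
    Set (ModelSpace P F (UProd μ L) → UProd μ X) :=
  {g | ∃ f : ∀ i, ModelSpace P F (L i) → X i, (∀ i, f i ∈ A i) ∧ g = uChart μ f}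

end UltraModel

end Model

end LambdaBuilding

open LambdaBuilding

/-!
The proof is an application of Łoś's theorem, carried out by hand. For subsets `Sᵢ ⊆ Xᵢ` the
ultraproduct `UProd.set S` is a subset of `∏_μ Xᵢ`, and inclusions, equalities, intersections,
nonemptiness and images of such sets hold in the ultraproduct if and only if they hold on a set of
measure one (`UProd.set_subset_set`, `UProd.set_nonempty`, `UProd.image_map_set`). Each axiom of a
building then passes to the ultraproduct, provided that the sets which occur in it are ultraproducts
of the corresponding sets in the factors. Three facts of finiteness ensure this.

* The root system has finite rank. In the coordinates of a basis the canonical map is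
  `(∏_μ Λᵢ)ⁿ → ∏_μ Λᵢⁿ`, hence it is bijective (`modelToUProd_bijective`). Coroots, the action of the
  spherical Weyl group and the distance of the model space commute with it.
* The spherical Weyl group is finite, so it agrees with its ultrapower. This gives
  `W(∏_μ Λᵢ) ≃ ∏_μ W(Λᵢ)` (`affineWeylToUProd_bijective`), whence Weyl chambers and transition maps of
  the ultraproduct come from the factors.
* The set of roots is finite. A half-apartment has the form `{x | c ≤ ⟨x, α^∨⟩}`
  (`isHalfApartment_iff`), and as `Λ` is totally ordered a convex set is the intersection of at most
  one of these for each root `α` (`isConvex_iff`). The number of half-apartments needed is therefore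
  bounded independently of the factor, which is what makes the convexity in `A2` a first-order
  condition (`uAtlas_transition`).

In a building the distance is independent of the chart, since the affine Weyl group acts on the model
space by isometries, and the retractions of `A5` give the triangle inequality
(`IsAffineBuilding.isLambdaMetric_chartDist`). Computing distances in a chart of the ultraproduct
shows that they are the ultraproducts of the distances of the factors (`chartDist_uAtlas`), which
reduces `A5` and the metric axioms to the factors.
-/

namespace LambdaBuilding

/-! ### Ultraproducts of sets, maps and finite types -/

namespace UProd

variable {I : Type*} {μ : Ultrafilter I} {X Y : I → Type*}

/-- A finite type agrees with its ultrapower: a sequence in it is constant on a set of measure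
one. -/
theorem exists_eventually_eq_const {C : Type*} [Finite C] (c : I → C) :
    ∃ c₀, ∀ᶠ i in (μ : Filter I), c i = c₀ :=
  Ultrafilter.eventually_exists_iff.1 (Filter.Eventually.of_forall fun i => ⟨c i, rfl⟩)

/-- The ultraproduct of a sequence of subsets, as a subset of the ultraproduct: the classes of the
sequences that lie in the subsets on a set of measure one. -/
def set (S : ∀ i, Set (X i)) : Set (UProd μ X) :=
  {x | ∃ y : ∀ i, X i, x = mk μ y ∧ ∀ᶠ i in (μ : Filter I), y i ∈ S i}

theorem mk_mem_set {S : ∀ i, Set (X i)} {x : ∀ i, X i} :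
    mk μ x ∈ set (μ := μ) S ↔ ∀ᶠ i in (μ : Filter I), x i ∈ S i := by
  constructor
  · rintro ⟨y, hxy, hy⟩
    filter_upwards [mk_eq_mk.1 hxy, hy] with i h h'
    rwa [h]
  · exact fun h => ⟨x, rfl, h⟩

/-- Łoś's theorem for inclusions of ultraproducts of subsets. -/
theorem set_subset_set [∀ i, Nonempty (X i)] {S T : ∀ i, Set (X i)} :
    set (μ := μ) S ⊆ set T ↔ ∀ᶠ i in (μ : Filter I), S i ⊆ T i := by
  classical
  constructor
  · intro h
    by_contra hn
    rw [← Ultrafilter.eventually_not] at hn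
    -- choose counterexamples to the inclusions wherever there are any
    have hx : ∀ i, ∃ x : X i, ¬ S i ⊆ T i → x ∈ S i ∧ x ∉ T i := fun i => by
      by_cases hi : S i ⊆ T i
      · exact ⟨Classical.arbitrary _, fun h => absurd hi h⟩
      · obtain ⟨x, hx⟩ := Set.not_subset.1 hi
        exact ⟨x, fun _ => hx⟩
    choose x hx using hx
    have hS : mk μ x ∈ set (μ := μ) S := mk_mem_set.2 (hn.mono fun i hi => (hx i hi).1)
    obtain ⟨i, hi, hi'⟩ := (hn.and (mk_mem_set.1 (h hS))).exists
    exact (hx i hi).2 hi'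
  · intro h x hx
    obtain ⟨x, rfl⟩ := mk_surjective x
    rw [mk_mem_set] at hx ⊢
    filter_upwards [h, hx] with i hi hxi using hi hxi

theorem set_eq_set [∀ i, Nonempty (X i)] {S T : ∀ i, Set (X i)} :
    set (μ := μ) S = set T ↔ ∀ᶠ i in (μ : Filter I), S i = T i := by
  simp only [Set.Subset.antisymm_iff, set_subset_set, Filter.eventually_and]

theorem set_inter_set {S T : ∀ i, Set (X i)} :
    set (μ := μ) S ∩ set T = set fun i => S i ∩ T i := by
  ext x
  obtain ⟨x, rfl⟩ := mk_surjective x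
  simp only [Set.mem_inter_iff, mk_mem_set, Filter.eventually_and]

theorem set_nonempty [∀ i, Nonempty (X i)] {S : ∀ i, Set (X i)} :
    (set (μ := μ) S).Nonempty ↔ ∀ᶠ i in (μ : Filter I), (S i).Nonempty := by
  classical
  constructor
  · rintro ⟨_, x, rfl, hx⟩
    exact hx.mono fun i hi => ⟨x i, hi⟩
  · intro h
    refine ⟨mk μ fun i => if hi : (S i).Nonempty then hi.some else Classical.arbitrary _,
      mk_mem_set.2 (h.mono fun i hi => ?_)⟩
    simp only [dif_pos hi]
    exact hi.some_mem

theorem image_map_set [∀ i, Nonempty (X i)] (f : ∀ i, X i → Y i) (S : ∀ i, Set (X i)) :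
    map f '' set (μ := μ) S = set fun i => f i '' S i := by
  ext y
  obtain ⟨y, rfl⟩ := mk_surjective y
  rw [mk_mem_set]
  constructor
  · rintro ⟨_, ⟨x, rfl, hx⟩, hxy⟩
    rw [map_mk, mk_eq_mk] at hxy
    filter_upwards [hx, hxy] with i hi hi' using ⟨x i, hi, hi'⟩
  · intro h
    choose x hx using fun i => show ∃ x : X i, y i ∈ f i '' S i → x ∈ S i ∧ f i x = y i by
      by_cases hi : y i ∈ f i '' S i
      · obtain ⟨x, hx⟩ := hi
        exact ⟨x, fun _ => hx⟩
      · exact ⟨Classical.arbitrary _, fun h => absurd h hi⟩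
    exact ⟨mk μ x, mk_mem_set.2 (h.mono fun i hi => (hx i hi).1),
      mk_eq_mk.2 (h.mono fun i hi => (hx i hi).2)⟩

theorem set_univ : set (μ := μ) (fun i => (Set.univ : Set (X i))) = Set.univ := by
  ext x
  obtain ⟨x, rfl⟩ := mk_surjective x
  simp [mk_mem_set]

theorem range_map [∀ i, Nonempty (X i)] (f : ∀ i, X i → Y i) :
    Set.range (map (μ := μ) f) = set fun i => Set.range (f i) := by
  rw [← Set.image_univ, ← set_univ, image_map_set]
  simp only [Set.image_univ]

theorem map_injective {f : ∀ i, X i → Y i} (hf : ∀ i, Function.Injective (f i)) :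
    Function.Injective (map (μ := μ) f) := fun x y h => by
  obtain ⟨x, rfl⟩ := mk_surjective x
  obtain ⟨y, rfl⟩ := mk_surjective y
  exact mk_eq_mk.2 ((mk_eq_mk.1 h).mono fun i hi => hf i hi)

/-- The ultraproduct of a sequence of linear maps. -/
def mapₗ {R : Type*} [Semiring R] [∀ i, AddCommGroup (X i)] [∀ i, AddCommGroup (Y i)]
    [∀ i, Module R (X i)] [∀ i, Module R (Y i)] (f : ∀ i, X i →ₗ[R] Y i) :
    UProd μ X →ₗ[R] UProd μ Y where
  toFun := map fun i => f i
  map_add' x y := by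
    obtain ⟨x, rfl⟩ := mk_surjective x
    obtain ⟨y, rfl⟩ := mk_surjective y
    exact congrArg (mk μ) (funext fun i => map_add (f i) (x i) (y i))
  map_smul' c x := by
    obtain ⟨x, rfl⟩ := mk_surjective x
    exact congrArg (mk μ) (funext fun i => map_smul (f i) c (x i))

theorem mk_abs [∀ i, AddCommGroup (X i)] [∀ i, LinearOrder (X i)] (x : ∀ i, X i) :
    |mk μ x| = mk μ fun i => |x i| := by
  rcases le_total (mk μ x) (-mk μ x) with h | h
  · rw [abs, max_eq_right h]
    exact mk_eq_mk.2 (Filter.Eventually.mono h fun i hi => (max_eq_right hi).symm)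
  · rw [abs, max_eq_left h]
    exact mk_eq_mk.2 (Filter.Eventually.mono h fun i hi => (max_eq_left hi).symm)

theorem mk_sum [∀ i, AddCommGroup (X i)] {κ : Type*} (s : Finset κ) (x : κ → ∀ i, X i) :
    ∑ k ∈ s, mk μ (x k) = mk μ fun i => ∑ k ∈ s, x k i := by
  have h := map_sum
    ({ toFun := mk μ, map_zero' := rfl, map_add' := fun _ _ => rfl } : (∀ i, X i) →+ UProd μ X) x s
  refine h.symm.trans (congrArg (mk μ) (funext fun i => ?_))
  exact Finset.sum_apply i s x

end UProd

theorem IsLambdaMetric.uDist {I : Type*} (μ : Ultrafilter I) {X L : I → Type*}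
    [∀ i, AddCommGroup (L i)] [∀ i, LinearOrder (L i)] {d : ∀ i, X i → X i → L i}
    (hd : ∀ i, IsLambdaMetric (d i)) : IsLambdaMetric (uDist μ d) where
  nonneg x y := by
    obtain ⟨x, rfl⟩ := UProd.mk_surjective x
    obtain ⟨y, rfl⟩ := UProd.mk_surjective y
    exact Filter.Eventually.of_forall fun i => (hd i).nonneg _ _
  eq_zero_iff x y := by
    obtain ⟨x, rfl⟩ := UProd.mk_surjective x
    obtain ⟨y, rfl⟩ := UProd.mk_surjective y
    refine UProd.mk_eq_mk.trans (Iff.trans ?_ UProd.mk_eq_mk.symm)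
    exact Filter.eventually_congr (Filter.Eventually.of_forall fun i => (hd i).eq_zero_iff _ _)
  symm x y := by
    obtain ⟨x, rfl⟩ := UProd.mk_surjective x
    obtain ⟨y, rfl⟩ := UProd.mk_surjective y
    exact UProd.mk_eq_mk.2 (Filter.Eventually.of_forall fun i => (hd i).symm _ _)
  triangle x y z := by
    obtain ⟨x, rfl⟩ := UProd.mk_surjective x
    obtain ⟨y, rfl⟩ := UProd.mk_surjective y
    obtain ⟨z, rfl⟩ := UProd.mk_surjective z
    exact Filter.Eventually.of_forall fun i => (hd i).triangle _ _ _

noncomputable section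

variable {ι V N : Type*} [Fintype ι] [AddCommGroup V] [Module ℝ V] [AddCommGroup N] [Module ℝ N]
variable {P : RootPairing ι ℝ V N} [P.IsRootSystem]

/-! ### The spherical Weyl group and the simple roots -/

/-- The spherical Weyl group is finite since it acts faithfully on the finite set of roots, which
span. -/
instance finite_weylGroup : Finite P.weylGroup := by
  refine Finite.of_injective (fun w : P.weylGroup => P.weylGroupToPerm w) fun v w h => ?_
  refine Subtype.ext (RootPairing.Equiv.weightHom_injective P ?_)
  refine LinearEquiv.toLinearMap_injective
    (LinearMap.ext_on_range (RootPairing.IsRootSystem.span_root_eq_top (P := P)) fun i => ?_)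
  change v • P.root i = w • P.root i
  rw [P.weylGroup_apply_root, P.weylGroup_apply_root]
  exact congrArg (fun σ : ι ≃ ι => P.root (σ i)) h

omit [Fintype ι] [P.IsRootSystem] in
theorem coroot'_weylGroup_smul (w : P.weylGroup) (j : ι) (v : V) :
    P.coroot' j (w • v) = P.coroot' ((P.weylGroupToPerm w).symm j) v := by
  change P.toLinearMap ((w : P.Aut).weightMap v) (P.coroot j) = P.toLinearMap v (P.coroot _)
  have h := LinearMap.congr_fun
    (RootPairing.Hom.weight_coweight_transpose_apply P P (P.coroot j) (w : P.Aut).toHom) v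
  rw [RootPairing.Hom.coroot_coweightMap_apply] at h
  exact h

namespace SimpleRoots

omit [Fintype ι] in
theorem card_support (B : SimpleRoots P) : B.support.card = Module.finrank ℝ V := by
  have hspan : Submodule.span ℝ (Set.range fun j : B.support => P.root j) = ⊤ := by
    rw [eq_top_iff, ← RootPairing.IsRootSystem.span_root_eq_top (P := P), Submodule.span_le]
    rintro _ ⟨i, rfl⟩
    obtain ⟨c, -, hc⟩ := B.root_mem_cone i
    have hs : ∑ j ∈ B.support, c j • P.root j ∈
        Submodule.span ℝ (Set.range fun j : B.support => P.root j) :=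
      Submodule.sum_mem _ fun j hj =>
        Submodule.smul_mem _ _ (Submodule.subset_span ⟨⟨j, hj⟩, rfl⟩)
    rcases hc with hc | hc
    · exact hc ▸ hs
    · exact hc ▸ Submodule.neg_mem _ hs
  rw [Module.finrank_eq_card_basis (Module.Basis.mk B.linearIndepOn hspan.ge)]
  exact (Fintype.card_coe B.support).symm

omit [Fintype ι] [P.IsRootSystem] in
/-- Of two opposite roots exactly one is positive. -/
theorem isPos_reflectionPerm_self_iff (B : SimpleRoots P) (i : ι) :
    B.IsPos (P.reflectionPerm i i) ↔ ¬ B.IsPos i := by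
  constructor
  · rintro ⟨c, hc, hci⟩ ⟨d, hd, hdi⟩
    rw [P.root_reflectionPerm, P.reflection_apply_self] at hci
    -- a nonnegative combination of the simple roots that vanishes is trivial
    have h0 : ∑ j ∈ B.support, (c j + d j) • P.root j = 0 := by
      simp only [add_smul, Finset.sum_add_distrib, ← hci, ← hdi, neg_add_cancel]
    have h1 := linearIndepOn_finset_iff.1 B.linearIndepOn _ h0
    refine P.ne_zero i ?_
    rw [hdi]
    refine Finset.sum_eq_zero fun j hj => ?_
    have := h1 j hj
    rw [show d j = 0 by linarith [hc j, hd j], zero_smul]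
  · intro h
    obtain ⟨c, hc, hci | hci⟩ := B.root_mem_cone i
    · exact absurd ⟨c, hc, hci⟩ h
    · exact ⟨c, hc, by rw [P.root_reflectionPerm, P.reflection_apply_self, hci, neg_neg]⟩

end SimpleRoots

variable {F : Subfield ℝ} [P.IsValuedIn F]

/-! ### Coroots, coordinates and distance on the model space -/

/-- Linear forms without a common zero span the dual of a finite-dimensional space. -/
theorem span_eq_top_of_no_common_zero {K E : Type*} [Field K] [AddCommGroup E] [Module K E]
    [FiniteDimensional K E] {s : Set (Module.Dual K E)}
    (h : ∀ v, (∀ φ ∈ s, φ v = 0) → v = 0) : Submodule.span K s = ⊤ := by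
  have h0 : (Submodule.span K s).dualCoannihilator = ⊥ :=
    (Submodule.eq_bot_iff _).2 fun v hv =>
      h v fun φ hφ => (Submodule.mem_dualCoannihilator v).1 hv φ (Submodule.subset_span hφ)
  rw [← Subspace.dualCoannihilator_dualAnnihilator_eq (W := Submodule.span K s), h0,
    Submodule.dualAnnihilator_bot]

section Field

namespace ModelSpace

variable {Λ : Type*} [AddCommGroup Λ] [Module F Λ]

omit [Fintype ι] [P.IsRootSystem] [P.IsValuedIn F] in
theorem hom_ext {M : Type*} [AddCommGroup M] [Module F M] {f g : ModelSpace P F Λ →ₗ[F] M}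
    (h : ∀ (v : P.rootSpan F) (l : Λ), f (tmul v l) = g (tmul v l)) : f = g :=
  TensorProduct.ext' h

omit [Fintype ι] [P.IsRootSystem] in
theorem corootEval_tmul (j : ι) (v : P.rootSpan F) (l : Λ) :
    corootEval P F Λ j (tmul v l) = P.coroot'In F j v • l := rfl

omit [Fintype ι] [P.IsRootSystem] [P.IsValuedIn F] in
theorem weylModel_tmul (w : P.weylGroup) (v : P.rootSpan F) (l : Λ) :
    weylModel P F Λ w (tmul v l) = tmul (weylSpan P F w v) l := rfl

theorem coords_tmul (B : SimpleRoots P) (v : P.rootSpan F) (l : Λ) (b : B.support) :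
    coords P F Λ B (tmul v l) b = (B.basis F).repr v b • l := by
  classical
  exact TensorProduct.equivFinsuppOfBasisLeft_apply_tmul_apply (B.basis F) v l b

omit [Fintype ι] [P.IsRootSystem] in
theorem corootEval_weylModel (w : P.weylGroup) (j : ι) (x : ModelSpace P F Λ) :
    corootEval P F Λ j (weylModel P F Λ w x) =
      corootEval P F Λ ((P.weylGroupToPerm w).symm j) x := by
  refine LinearMap.congr_fun (f := corootEval P F Λ j ∘ₗ weylModel P F Λ w) (hom_ext ?_) x
  intro v l
  rw [LinearMap.comp_apply, weylModel_tmul, corootEval_tmul, corootEval_tmul]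
  congr 1
  apply FaithfulSMul.algebraMap_injective F ℝ
  rw [P.algebraMap_coroot'In_apply, P.algebraMap_coroot'In_apply]
  exact coroot'_weylGroup_smul w j v

omit [Fintype ι] [P.IsRootSystem] in
theorem corootEval_reflectionPerm_self (i : ι) (x : ModelSpace P F Λ) :
    corootEval P F Λ (P.reflectionPerm i i) x = -corootEval P F Λ i x := by
  refine LinearMap.congr_fun (g := -corootEval P F Λ i) (hom_ext ?_) x
  intro v l
  rw [LinearMap.neg_apply, corootEval_tmul, corootEval_tmul, ← neg_smul]
  congr 1
  apply FaithfulSMul.algebraMap_injective F ℝ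
  rw [map_neg, P.algebraMap_coroot'In_apply, P.algebraMap_coroot'In_apply]
  change P.toLinearMap v _ = - P.toLinearMap v _
  rw [P.coroot_reflectionPerm, P.coreflection_apply_self, map_neg]

omit [Fintype ι] [P.IsRootSystem] in
theorem corootEval_surjective (j : ι) : Function.Surjective (corootEval P F Λ j) := fun l => by
  -- `⟨α, α^∨⟩ = 2`, so `α ⊗ l / 2` is mapped to `l`
  refine ⟨tmul (P.rootSpanMem F j) ((2 : F)⁻¹ • l), ?_⟩
  rw [corootEval_tmul, P.coroot'In_rootSpanMem_eq_pairingIn, P.pairingIn_same, smul_smul,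
    mul_inv_cancel₀ two_ne_zero, one_smul]

variable (P F) in
/-- The coroots span the dual of the `F`-span of the roots, since they have no common zero. -/
theorem span_coroot'In_eq_top (B : SimpleRoots P) :
    Submodule.span F (Set.range fun j => P.coroot'In F j) = ⊤ := by
  have : FiniteDimensional F (P.rootSpan F) := .of_basis (B.basis F)
  refine span_eq_top_of_no_common_zero fun v hv => ?_
  by_contra hne
  obtain ⟨j, hj⟩ := P.exists_coroot_ne F hne
  exact hj (hv _ ⟨j, rfl⟩)

/-- A point of the model space on which all coroots vanish is zero. -/
theorem eq_zero_of_corootEval (B : SimpleRoots P) {x : ModelSpace P F Λ}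
    (h : ∀ j, corootEval P F Λ j x = 0) : x = 0 := by
  refine (coords P F Λ B).map_eq_zero_iff.1 (funext fun b => ?_)
  have hb : (B.basis F).coord b ∈ Submodule.span F (Set.range fun j => P.coroot'In F j) := by
    rw [span_coroot'In_eq_top P F B]; trivial
  obtain ⟨c, hc⟩ := (Submodule.mem_span_range_iff_exists_fun F).1 hb
  -- the coordinate `b` is an `F`-linear combination of coroots
  have hf : LinearMap.proj b ∘ₗ (coords P F Λ B).toLinearMap =
      ∑ j, c j • corootEval P F Λ j := by
    refine hom_ext fun v l => ?_
    have hv : (B.basis F).repr v b = ∑ j, c j * P.coroot'In F j v := by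
      simpa using (LinearMap.congr_fun hc v).symm
    simp only [LinearMap.sum_apply, LinearMap.smul_apply, corootEval_tmul, smul_smul,
      ← Finset.sum_smul]
    rw [← hv]
    exact coords_tmul B v l b
  have := LinearMap.congr_fun hf x
  simpa [h] using this

end ModelSpace

open ModelSpace

variable {Λ : Type*} [AddCommGroup Λ] [Module F Λ]

namespace AffineWeyl

omit [Fintype ι] [P.IsRootSystem] [P.IsValuedIn F] in
theorem act_one (x : ModelSpace P F Λ) : (1 : AffineWeyl P F Λ).act x = x := by
  simp [act]

omit [Fintype ι] [P.IsRootSystem] [P.IsValuedIn F] in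
theorem act_mul (v w : AffineWeyl P F Λ) (x : ModelSpace P F Λ) :
    (v * w).act x = v.act (w.act x) := by
  simp only [act, SemidirectProduct.mul_left, SemidirectProduct.mul_right, toAdd_mul, map_mul,
    map_add, add_assoc]
  rfl

omit [Fintype ι] [P.IsRootSystem] [P.IsValuedIn F] in
theorem act_inv_act (w : AffineWeyl P F Λ) (x : ModelSpace P F Λ) : w⁻¹.act (w.act x) = x := by
  rw [← act_mul, inv_mul_cancel, act_one]

omit [Fintype ι] [P.IsRootSystem] [P.IsValuedIn F] in
theorem act_act_inv (w : AffineWeyl P F Λ) (x : ModelSpace P F Λ) : w.act (w⁻¹.act x) = x := by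
  rw [← act_mul, mul_inv_cancel, act_one]

end AffineWeyl

variable [LinearOrder Λ]

/-- The half-space of the points `x` with `c ≤ ⟨x, α^∨⟩`, for the root `α` with index `j`. -/
def halfSpace (j : ι) (c : Λ) : Set (ModelSpace P F Λ) := {x | c ≤ corootEval P F Λ j x}

section IsOrderedAddMonoid

variable [IsOrderedAddMonoid Λ]

omit [Fintype ι] [P.IsRootSystem] in
/-- The Weyl group permutes the roots, and every `c` occurs since coroots are surjective onto `Λ`. -/
theorem isHalfApartment_iff {H : Set (ModelSpace P F Λ)} :
    IsHalfApartment H ↔ ∃ j c, H = halfSpace j c := by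
  have key : ∀ (w : AffineWeyl P F Λ) (i : ι), w.act '' {x | 0 ≤ corootEval P F Λ i x} =
      halfSpace (P.weylGroupToPerm w.right i)
        (corootEval P F Λ (P.weylGroupToPerm w.right i) w.left.toAdd) := by
    intro w i
    ext y
    have hy : corootEval P F Λ (P.weylGroupToPerm w.right i) y =
        corootEval P F Λ (P.weylGroupToPerm w.right i) w.left.toAdd +
          corootEval P F Λ i (w⁻¹.act y) := by
      conv_lhs => rw [← w.act_act_inv y]
      rw [AffineWeyl.act, map_add, corootEval_weylModel, Equiv.symm_apply_apply]
    simp only [halfSpace, Set.mem_ofPred_eq, hy, le_add_iff_nonneg_right]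
    constructor
    · rintro ⟨x, hx, rfl⟩
      rwa [AffineWeyl.act_inv_act]
    · exact fun h => ⟨_, h, w.act_act_inv y⟩
  constructor
  · rintro ⟨w, i, rfl⟩
    exact ⟨_, _, key w i⟩
  · rintro ⟨j, c, rfl⟩
    obtain ⟨t, rfl⟩ := corootEval_surjective (P := P) (F := F) j c
    refine ⟨AffineWeyl.mk' t 1, j, ?_⟩
    rw [key]
    simp [AffineWeyl.mk']

omit [P.IsRootSystem] in
/-- A convex set is an intersection of at most one half-space for each root: of several
half-spaces of one root the smallest suffices. -/
theorem isConvex_iff {Y : Set (ModelSpace P F Λ)} :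
    IsConvex Y ↔ ∃ (J : Set ι) (c : ι → Λ), Y = ⋂ j ∈ J, halfSpace j (c j) := by
  classical
  constructor
  · rintro ⟨𝓗, hfin, hH, rfl⟩
    induction 𝓗, hfin using Set.Finite.induction_on with
    | empty => exact ⟨∅, fun _ => 0, by simp⟩
    | insert _ _ ih =>
      rename_i H 𝓗 _ _
      obtain ⟨J, c, hY⟩ := ih fun H' hH' => hH H' (Set.mem_insert_of_mem _ hH')
      obtain ⟨k, d, rfl⟩ := isHalfApartment_iff.1 (hH H (Set.mem_insert _ _))
      refine ⟨insert k J, Function.update c k (if k ∈ J then max (c k) d else d), ?_⟩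
      rw [Set.sInter_insert, hY]
      ext x
      simp only [Set.mem_inter_iff, Set.mem_iInter, Set.mem_insert_iff, halfSpace,
        Set.mem_ofPred_eq]
      constructor
      · rintro ⟨hd, hc⟩ j hj
        by_cases hjk : j = k
        · subst hjk
          rw [Function.update_self]
          split_ifs with hJ
          · exact max_le (hc j hJ) hd
          · exact hd
        · rw [Function.update_of_ne hjk]
          exact hc j (hj.resolve_left hjk)
      · intro h
        have hk := h k (Or.inl rfl)
        rw [Function.update_self] at hk
        refine ⟨?_, fun j hj => ?_⟩
        · split_ifs at hk with hJ
          · exact (le_max_right _ _).trans hk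
          · exact hk
        · by_cases hjk : j = k
          · subst hjk
            rw [if_pos hj] at hk
            exact (le_max_left _ _).trans hk
          · simpa [Function.update_of_ne hjk] using h j (Or.inr hj)
  · rintro ⟨J, c, rfl⟩
    refine ⟨(fun j => halfSpace j (c j)) '' J, J.toFinite.image _, ?_, by simp⟩
    rintro _ ⟨j, -, rfl⟩
    exact isHalfApartment_iff.2 ⟨j, c j, rfl⟩

omit [P.IsRootSystem] [IsOrderedAddMonoid Λ] in
/-- Twice the distance is the sum over all roots. -/
theorem two_nsmul_modelDist (B : SimpleRoots P) (x y : ModelSpace P F Λ) :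
    2 • modelDist B x y = ∑ i, |corootEval P F Λ i (y - x)| := by
  classical
  have hrefl (i : ι) : P.reflectionPerm (P.reflectionPerm i i) (P.reflectionPerm i i) = i := by
    apply P.root.injective
    rw [P.root_reflectionPerm, P.reflection_apply_self, P.root_reflectionPerm,
      P.reflection_apply_self, neg_neg]
  rw [← Finset.sum_filter_add_sum_filter_not Finset.univ (fun i => B.IsPos i), two_nsmul]
  congr 1
  refine Finset.sum_bij' (fun i _ => P.reflectionPerm i i) (fun i _ => P.reflectionPerm i i)
    ?_ ?_ ?_ ?_ ?_
  · intro i hi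
    simpa [B.isPos_reflectionPerm_self_iff] using hi
  · intro i hi
    simpa [B.isPos_reflectionPerm_self_iff] using hi
  · intro i _
    exact hrefl i
  · intro i _
    exact hrefl i
  · intro i _
    rw [corootEval_reflectionPerm_self, abs_neg]

omit [P.IsRootSystem] in
theorem modelDist_act (B : SimpleRoots P) (w : AffineWeyl P F Λ) (x y : ModelSpace P F Λ) :
    modelDist B (w.act x) (w.act y) = modelDist B x y := by
  refine nsmul_right_injective (two_ne_zero (α := ℕ)) ?_
  simp only [two_nsmul_modelDist]
  refine Fintype.sum_equiv (P.weylGroupToPerm w.right).symm _ _ fun i => ?_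
  rw [AffineWeyl.act, AffineWeyl.act, add_sub_add_left_eq_sub, ← map_sub, corootEval_weylModel]

theorem isLambdaMetric_modelDist (B : SimpleRoots P) :
    IsLambdaMetric (modelDist B : ModelSpace P F Λ → ModelSpace P F Λ → Λ) where
  nonneg x y := Finset.sum_nonneg fun _ _ => abs_nonneg _
  eq_zero_iff x y := by
    constructor
    · intro h
      have h2 := two_nsmul_modelDist B x y
      rw [h, smul_zero, eq_comm, Finset.sum_eq_zero_iff_of_nonneg fun _ _ => abs_nonneg _] at h2
      exact (sub_eq_zero.1 (eq_zero_of_corootEval B fun j =>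
        abs_eq_zero.1 (h2 j (Finset.mem_univ j)))).symm
    · rintro rfl
      simp [modelDist]
  symm x y := by
    refine Finset.sum_congr rfl fun i _ => ?_
    rw [← neg_sub, map_neg, abs_neg]
  triangle x y z := by
    rw [modelDist, modelDist, modelDist, ← Finset.sum_add_distrib]
    refine Finset.sum_le_sum fun i _ => ?_
    rw [← sub_add_sub_cancel z y x, map_add, add_comm]
    exact abs_add_le _ _

variable [Nontrivial Λ]

namespace IsAffineBuilding

/-! ### The distance of a building -/

variable {X : Type*} {B : SimpleRoots P} {A : Set (ModelSpace P F Λ → X)}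

omit [P.IsRootSystem] in
/-- The distance does not depend on the chart: the transition maps belong to the affine Weyl group,
which preserves the distance of the model space. -/
theorem chartDist_apply (hA : IsAffineBuilding B A) {f : ModelSpace P F Λ → X} (hf : f ∈ A)
    (a b : ModelSpace P F Λ) : chartDist B A (f a) (f b) = modelDist B a b := by
  have h : ∃ l, HasChartDist B A (f a) (f b) l := ⟨_, f, hf, a, b, rfl, rfl, rfl⟩
  rw [chartDist, dif_pos h]
  obtain ⟨g, hg, a', b', ha, hb, hl⟩ := h.choose_spec
  obtain ⟨-, w, hw⟩ := hA.A2 f hf g hg ⟨f a, ⟨a, rfl⟩, ⟨a', ha⟩⟩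
  have ha' : a' = w.act a := hA.injective g hg (by rw [ha, hw a ⟨a', ha⟩])
  have hb' : b' = w.act b := hA.injective g hg (by rw [hb, hw b ⟨b', hb⟩])
  rw [hl, ha', hb', modelDist_act]

/-- The triangle inequality is proved by retracting onto an apartment through the two outer
points. -/
theorem isLambdaMetric_chartDist (hA : IsAffineBuilding B A) : IsLambdaMetric (chartDist B A) where
  nonneg x y := by
    obtain ⟨f, hf, ⟨a, rfl⟩, ⟨b, rfl⟩⟩ := hA.A3 x y
    rw [hA.chartDist_apply hf]
    exact (isLambdaMetric_modelDist B).nonneg a b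
  eq_zero_iff x y := by
    obtain ⟨f, hf, ⟨a, rfl⟩, ⟨b, rfl⟩⟩ := hA.A3 x y
    rw [hA.chartDist_apply hf, (isLambdaMetric_modelDist B).eq_zero_iff,
      (hA.injective f hf).eq_iff]
  symm x y := by
    obtain ⟨f, hf, ⟨a, rfl⟩, ⟨b, rfl⟩⟩ := hA.A3 x y
    rw [hA.chartDist_apply hf, hA.chartDist_apply hf, (isLambdaMetric_modelDist B).symm]
  triangle x y z := by
    obtain ⟨f, hf, hx, hz⟩ := hA.A3 x z
    obtain ⟨r, hr, hfix, hle, -⟩ := hA.A5 f hf x hx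
    refine le_trans ?_ (add_le_add (hle x y) (hle y z))
    rw [hfix x hx, hfix z hz]
    obtain ⟨a, rfl⟩ := hx
    obtain ⟨c, rfl⟩ := hz
    obtain ⟨b, hb⟩ := hr y
    rw [← hb, hA.chartDist_apply hf, hA.chartDist_apply hf, hA.chartDist_apply hf]
    exact (isLambdaMetric_modelDist B).triangle a b c

end IsAffineBuilding

end IsOrderedAddMonoid

end Field

variable {I : Type*} {μ : Ultrafilter I} {L : I → Type*} [∀ i, AddCommGroup (L i)]
  [∀ i, Module F (L i)]

/-! ### Ultraproducts of model spaces -/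

omit [Fintype ι] [P.IsRootSystem] in
theorem corootEval_uProd (j : ι) (x : ModelSpace P F (UProd μ L)) :
    corootEval P F (UProd μ L) j x =
      UProd.map (fun i => corootEval P F (L i) j) (modelToUProd P F μ L x) := by
  refine LinearMap.congr_fun (g := UProd.mapₗ (fun i => corootEval P F (L i) j) ∘ₗ
    modelToUProd P F μ L) (ModelSpace.hom_ext fun v l => ?_) x
  obtain ⟨l, rfl⟩ := UProd.mk_surjective l
  rfl

theorem coords_uProd (B : SimpleRoots P) (b : B.support) (x : ModelSpace P F (UProd μ L)) :
    coords P F (UProd μ L) B x b =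
      UProd.map (fun i y => coords P F (L i) B y b) (modelToUProd P F μ L x) := by
  refine LinearMap.congr_fun (f := LinearMap.proj b ∘ₗ (coords P F (UProd μ L) B).toLinearMap)
    (g := UProd.mapₗ (fun i => LinearMap.proj b ∘ₗ (coords P F (L i) B).toLinearMap) ∘ₗ
      modelToUProd P F μ L) (ModelSpace.hom_ext fun v l => ?_) x
  obtain ⟨l, rfl⟩ := UProd.mk_surjective l
  refine (ModelSpace.coords_tmul B v _ b).trans ?_
  exact congrArg (UProd.mk μ) (funext fun i => (ModelSpace.coords_tmul B v (l i) b).symm)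

omit [Fintype ι] [P.IsRootSystem] [P.IsValuedIn F] in
theorem modelToUProd_weylModel (u : P.weylGroup) (x : ModelSpace P F (UProd μ L)) :
    modelToUProd P F μ L (weylModel P F (UProd μ L) u x) =
      UProd.map (fun i => weylModel P F (L i) u) (modelToUProd P F μ L x) := by
  refine LinearMap.congr_fun (f := modelToUProd P F μ L ∘ₗ weylModel P F (UProd μ L) u)
    (g := UProd.mapₗ (fun i => weylModel P F (L i) u) ∘ₗ
      modelToUProd P F μ L) (ModelSpace.hom_ext fun v l => ?_) x
  obtain ⟨l, rfl⟩ := UProd.mk_surjective l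
  rfl

variable (F μ L) in
/-- In coordinates the canonical map is the bijection `(∏_μ Λᵢ)ⁿ ≃ ∏_μ Λᵢⁿ`, a consequence of the
finiteness of `n`. -/
theorem modelToUProd_bijective (B : SimpleRoots P) :
    Function.Bijective (modelToUProd P F μ L) := by
  constructor
  · intro x y h
    refine (coords P F (UProd μ L) B).injective (funext fun b => ?_)
    rw [coords_uProd, coords_uProd, h]
  · intro y
    obtain ⟨s, rfl⟩ := UProd.mk_surjective y
    refine ⟨(coords P F (UProd μ L) B).symm fun b => UProd.mk μ fun i => coords P F (L i) B (s i) b,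
      ?_⟩
    set x := (coords P F (UProd μ L) B).symm fun b => UProd.mk μ fun i =>
      coords P F (L i) B (s i) b with hx
    obtain ⟨t, ht⟩ := UProd.mk_surjective (modelToUProd P F μ L x)
    rw [← ht, UProd.mk_eq_mk]
    have h : ∀ b, ∀ᶠ i in (μ : Filter I), coords P F (L i) B (t i) b = coords P F (L i) B (s i) b :=
      fun b => by
        have hb := coords_uProd B b x
        rw [hx, LinearEquiv.apply_symm_apply, ← hx, ← ht, UProd.map_mk, eq_comm] at hb
        exact UProd.mk_eq_mk.1 hb
    filter_upwards [Filter.eventually_all.2 h] with i hi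
    exact (coords P F (L i) B).injective (funext hi)

/-! ### Ultraproducts of affine Weyl groups -/

variable (P F μ L) in
/-- The homomorphism from the full affine Weyl group over `∏_μ Λᵢ` to the ultraproduct of the full
affine Weyl groups over the `Λᵢ` which sends `([tᵢ], u)` to `[(tᵢ, u)]`. -/
def affineWeylToUProd :
    AffineWeyl P F (UProd μ L) →* UProd μ (fun i => AffineWeyl P F (L i)) where
  toFun w := UProd.map (fun _ t => AffineWeyl.mk' t w.right)
    (modelToUProd P F μ L w.left.toAdd)
  map_one' := by
    rw [SemidirectProduct.one_left, toAdd_one, map_zero]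
    rfl
  map_mul' v w := by
    rw [SemidirectProduct.mul_left, SemidirectProduct.mul_right, toAdd_mul, map_add]
    change UProd.map _ (_ + modelToUProd P F μ L (weylModel P F _ v.right w.left.toAdd)) = _
    rw [modelToUProd_weylModel]
    obtain ⟨s, hs⟩ := UProd.mk_surjective (modelToUProd P F μ L v.left.toAdd)
    obtain ⟨t, ht⟩ := UProd.mk_surjective (modelToUProd P F μ L w.left.toAdd)
    rw [← hs, ← ht]
    rfl

omit [Fintype ι] [P.IsRootSystem] [P.IsValuedIn F] in
theorem affineWeylToUProd_mk' (u : P.weylGroup) {t : ModelSpace P F (UProd μ L)}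
    {s : ∀ i, ModelSpace P F (L i)} (h : modelToUProd P F μ L t = UProd.mk μ s) :
    affineWeylToUProd P F μ L (AffineWeyl.mk' t u) =
      UProd.mk μ fun i => AffineWeyl.mk' (s i) u :=
  congrArg (UProd.map (μ := μ) fun _ t => AffineWeyl.mk' t u) h

/-- Surjectivity uses that the spherical Weyl group is finite, so that it equals its
ultrapower. -/
theorem affineWeylToUProd_bijective (B : SimpleRoots P) :
    Function.Bijective (affineWeylToUProd P F μ L) := by
  constructor
  · rintro ⟨t, u⟩ ⟨t', u'⟩ h
    obtain ⟨s, hs⟩ := UProd.mk_surjective (modelToUProd P F μ L t.toAdd)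
    obtain ⟨s', hs'⟩ := UProd.mk_surjective (modelToUProd P F μ L t'.toAdd)
    have h' : UProd.map (fun _ t => AffineWeyl.mk' t u) (modelToUProd P F μ L t.toAdd) =
      UProd.map (fun _ t => AffineWeyl.mk' t u') (modelToUProd P F μ L t'.toAdd) := h
    rw [← hs, ← hs', UProd.map_mk, UProd.map_mk, UProd.mk_eq_mk] at h'
    obtain ⟨i, hi⟩ := h'.exists
    have hu : u = u' := congrArg SemidirectProduct.right hi
    have ht : modelToUProd P F μ L t.toAdd = modelToUProd P F μ L t'.toAdd := by
      rw [← hs, ← hs', UProd.mk_eq_mk]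
      exact h'.mono fun i hi => congrArg SemidirectProduct.left hi
    exact SemidirectProduct.ext ((modelToUProd_bijective F μ L B).1 ht) hu
  · intro w
    obtain ⟨w, rfl⟩ := UProd.mk_surjective w
    obtain ⟨u, hu⟩ := UProd.exists_eventually_eq_const (μ := μ) fun i => (w i).right
    obtain ⟨t, ht⟩ := (modelToUProd_bijective F μ L B).2 (UProd.mk μ fun i => (w i).left.toAdd)
    refine ⟨AffineWeyl.mk' t u, ?_⟩
    rw [affineWeylToUProd_mk' u ht, UProd.mk_eq_mk]
    filter_upwards [hu] with i hi
    exact SemidirectProduct.ext rfl hi.symm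

omit [Fintype ι] [P.IsRootSystem] [P.IsValuedIn F] in
theorem modelToUProd_act (w : AffineWeyl P F (UProd μ L)) (x : ModelSpace P F (UProd μ L)) :
    modelToUProd P F μ L (w.act x) =
      UProd.map₂ (fun _ => AffineWeyl.act) (affineWeylToUProd P F μ L w)
        (modelToUProd P F μ L x) := by
  obtain ⟨s, hs⟩ := UProd.mk_surjective (modelToUProd P F μ L w.left.toAdd)
  obtain ⟨t, ht⟩ := UProd.mk_surjective (modelToUProd P F μ L x)
  rw [AffineWeyl.act, map_add, modelToUProd_weylModel,
    show affineWeylToUProd P F μ L w = _ from affineWeylToUProd_mk' w.right hs.symm, ← hs, ← ht]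
  rfl

theorem weylCoords_coords {Λ : Type*} [AddCommGroup Λ] [Module F Λ] (B : SimpleRoots P)
    (u : P.weylGroup) (x : ModelSpace P F Λ) :
    weylCoords P F Λ B u (coords P F Λ B x) = coords P F Λ B (weylModel P F Λ u x) :=
  congrArg (fun y => coords P F Λ B (weylModel P F Λ u y)) ((coords P F Λ B).symm_apply_apply x)

/-- The isomorphism of semidirect products induced by an isomorphism of representations. -/
def semidirectCongr {G M M' : Type*} [Group G] [AddCommGroup M] [Module F M] [AddCommGroup M']
    [Module F M'] (ρ : Representation F G M) (ρ' : Representation F G M') (e : M ≃ₗ[F] M')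
    (h : ∀ g x, ρ' g (e x) = e (ρ g x)) :
    Multiplicative M ⋊[repAut F ρ] G ≃* Multiplicative M' ⋊[repAut F ρ'] G :=
  SemidirectProduct.congr e.toAddEquiv.toMultiplicative (MulEquiv.refl G) fun g =>
    MulEquiv.ext fun x => congrArg Multiplicative.ofAdd (h g x.toAdd).symm

/-! ### Ultraproducts of charts, half-apartments and Weyl chambers -/

variable {X : I → Type*}

omit [Fintype ι] [P.IsRootSystem] [P.IsValuedIn F] in
theorem uChart_of_modelToUProd_eq (f : ∀ i, ModelSpace P F (L i) → X i)
    {x : ModelSpace P F (UProd μ L)} {s : ∀ i, ModelSpace P F (L i)}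
    (h : modelToUProd P F μ L x = UProd.mk μ s) : uChart μ f x = UProd.mk μ fun i => f i (s i) := by
  rw [uChart, h, UProd.map_mk]

theorem uChart_injective (B : SimpleRoots P) {f : ∀ i, ModelSpace P F (L i) → X i}
    (hf : ∀ i, Function.Injective (f i)) : Function.Injective (uChart μ f) :=
  (UProd.map_injective hf).comp (modelToUProd_bijective F μ L B).1

omit [Fintype ι] [P.IsRootSystem] [P.IsValuedIn F] in
theorem uChart_comp_act (f : ∀ i, ModelSpace P F (L i) → X i) {w : AffineWeyl P F (UProd μ L)}
    {v : ∀ i, AffineWeyl P F (L i)} (h : affineWeylToUProd P F μ L w = UProd.mk μ v) :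
    uChart μ f ∘ w.act = uChart μ fun i => f i ∘ (v i).act := by
  funext x
  obtain ⟨s, hs⟩ := UProd.mk_surjective (modelToUProd P F μ L x)
  rw [uChart_of_modelToUProd_eq _ hs.symm]
  refine uChart_of_modelToUProd_eq f ?_
  rw [modelToUProd_act, h, ← hs, UProd.map₂_mk]

theorem uChart_image (B : SimpleRoots P) (f : ∀ i, ModelSpace P F (L i) → X i)
    (S : ∀ i, Set (ModelSpace P F (L i))) :
    uChart μ f '' (modelToUProd P F μ L ⁻¹' UProd.set S) = UProd.set fun i => f i '' S i := by
  rw [← UProd.image_map_set, ← Set.image_preimage_eq (UProd.set S)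
    (modelToUProd_bijective F μ L B).2, Set.image_image]
  rw [Set.image_preimage_eq (UProd.set S) (modelToUProd_bijective F μ L B).2]
  rfl

theorem range_uChart (B : SimpleRoots P) (f : ∀ i, ModelSpace P F (L i) → X i) :
    Set.range (uChart μ f) = UProd.set fun i => Set.range (f i) := by
  rw [← UProd.range_map]
  exact (modelToUProd_bijective F μ L B).2.range_comp _

section Ordered

variable [∀ i, LinearOrder (L i)]

omit [Fintype ι] [P.IsRootSystem] in
theorem halfSpace_uProd (j : ι) (c : ∀ i, L i) :
    halfSpace (P := P) (F := F) j (UProd.mk μ c) =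
      modelToUProd P F μ L ⁻¹' UProd.set fun i => halfSpace j (c i) := by
  ext x
  obtain ⟨s, hs⟩ := UProd.mk_surjective (modelToUProd P F μ L x)
  rw [halfSpace, Set.mem_ofPred_eq, corootEval_uProd, Set.mem_preimage, ← hs, UProd.mk_mem_set,
    UProd.map_mk, UProd.mk_le_mk]
  rfl

omit [P.IsRootSystem] in
theorem biInter_halfSpace_uProd (J : Set ι) (c : ι → ∀ i, L i) :
    ⋂ j ∈ J, halfSpace (P := P) (F := F) j (UProd.mk μ (c j)) =
      modelToUProd P F μ L ⁻¹' UProd.set fun i => ⋂ j ∈ J, halfSpace j (c j i) := by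
  ext x
  obtain ⟨s, hs⟩ := UProd.mk_surjective (modelToUProd P F μ L x)
  simp only [halfSpace_uProd, Set.mem_iInter, Set.mem_preimage, ← hs, UProd.mk_mem_set,
    Filter.eventually_all]

omit [P.IsRootSystem] in
theorem fundamentalChamber_uProd (B : SimpleRoots P) :
    (fundamentalChamber B : Set (ModelSpace P F (UProd μ L))) =
      modelToUProd P F μ L ⁻¹' UProd.set fun _ => fundamentalChamber B := by
  have h (Λ : Type _) [AddCommGroup Λ] [Module F Λ] [LinearOrder Λ] :
      (fundamentalChamber B : Set (ModelSpace P F Λ)) =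
        ⋂ j ∈ {j | B.IsPos j}, halfSpace j 0 := by
    ext x
    simp [fundamentalChamber, halfSpace]
  rw [h]
  refine (biInter_halfSpace_uProd {j | B.IsPos j} fun _ _ => 0).trans ?_
  congr 2
  funext i
  ext x
  simp [fundamentalChamber, halfSpace]

omit [P.IsRootSystem] in
theorem modelDist_uProd (B : SimpleRoots P) (x y : ModelSpace P F (UProd μ L)) :
    modelDist B x y = uDist μ (fun _ => modelDist B) (modelToUProd P F μ L x)
      (modelToUProd P F μ L y) := by
  obtain ⟨s, hs⟩ := UProd.mk_surjective (modelToUProd P F μ L x)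
  obtain ⟨t, ht⟩ := UProd.mk_surjective (modelToUProd P F μ L y)
  rw [← hs, ← ht]
  have h : ∀ j, |corootEval P F (UProd μ L) j (y - x)| =
      UProd.mk μ fun i => |corootEval P F (L i) j (t i - s i)| := fun j => by
    rw [corootEval_uProd, map_sub, ← hs, ← ht, ← UProd.mk_abs]
    rfl
  simp only [modelDist, h, UProd.mk_sum]
  rfl

variable {A : ∀ i, Set (ModelSpace P F (L i) → X i)} {B : SimpleRoots P}

/-- A Weyl chamber of the model space is cut out by finitely many inequalities, so it is the
ultraproduct of Weyl chambers of the factors. -/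
theorem isWeylChamberIn_uAtlas {S : Set (UProd μ X)} :
    IsWeylChamberIn B (uAtlas μ A) S ↔
      ∃ T : ∀ i, Set (X i), (∀ i, IsWeylChamberIn B (A i) (T i)) ∧ S = UProd.set T := by
  have key : ∀ (f : ∀ i, ModelSpace P F (L i) → X i) (w : AffineWeyl P F (UProd μ L))
      (v : ∀ i, AffineWeyl P F (L i)), affineWeylToUProd P F μ L w = UProd.mk μ v →
      uChart μ f '' (w.act '' fundamentalChamber B) =
        UProd.set fun i => f i '' ((v i).act '' fundamentalChamber B) := by
    intro f w v hv
    rw [← Set.image_comp, uChart_comp_act f hv, fundamentalChamber_uProd, uChart_image B]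
    simp only [Set.image_comp]
  constructor
  · rintro ⟨_, ⟨f, hf, rfl⟩, w, rfl⟩
    obtain ⟨v, hv⟩ := UProd.mk_surjective (affineWeylToUProd P F μ L w)
    exact ⟨_, fun i => ⟨f i, hf i, v i, rfl⟩, key f w v hv.symm⟩
  · rintro ⟨T, hT, rfl⟩
    choose f hf v hv using hT
    obtain ⟨w, hw⟩ := (affineWeylToUProd_bijective B).2 (UProd.mk μ v)
    refine ⟨_, ⟨f, hf, rfl⟩, w, ?_⟩
    rw [key f w v hw]
    exact congrArg _ (funext hv)

variable [∀ i, IsOrderedAddMonoid (L i)]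

theorem IsHalfApartmentIn.exists_eq_uProd_set (B : SimpleRoots P) {S : Set (UProd μ X)}
    (hS : IsHalfApartmentIn (uAtlas μ A) S) :
    ∃ T : ∀ i, Set (X i), (∀ i, IsHalfApartmentIn (A i) (T i)) ∧ S = UProd.set T := by
  obtain ⟨_, ⟨f, hf, rfl⟩, H, hH, rfl⟩ := hS
  obtain ⟨j, c, rfl⟩ := isHalfApartment_iff.1 hH
  obtain ⟨c, rfl⟩ := UProd.mk_surjective c
  refine ⟨fun i => f i '' halfSpace j (c i),
    fun i => ⟨f i, hf i, _, isHalfApartment_iff.2 ⟨j, c i, rfl⟩, rfl⟩, ?_⟩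
  rw [halfSpace_uProd, uChart_image B]

variable [∀ i, Nontrivial (L i)]

/-! ### The ultraproduct of buildings -/

theorem exists_uAtlas_range (hA : ∀ i, IsAffineBuilding B (A i)) (x y : UProd μ X) :
    ∃ f ∈ uAtlas μ A, x ∈ Set.range f ∧ y ∈ Set.range f := by
  obtain ⟨x, rfl⟩ := UProd.mk_surjective x
  obtain ⟨y, rfl⟩ := UProd.mk_surjective y
  choose f hf hx hy using fun i => (hA i).A3 (x i) (y i)
  refine ⟨_, ⟨f, hf, rfl⟩, ?_⟩
  rw [range_uChart B, UProd.mk_mem_set, UProd.mk_mem_set]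
  exact ⟨Filter.Eventually.of_forall hx, Filter.Eventually.of_forall hy⟩

theorem chartDist_uAtlas (hA : ∀ i, IsAffineBuilding B (A i)) :
    chartDist B (uAtlas μ A) = uDist μ fun i => chartDist B (A i) := by
  funext x y
  have h : ∃ l, HasChartDist B (uAtlas μ A) x y l := by
    obtain ⟨f, hf, ⟨a, ha⟩, ⟨b, hb⟩⟩ := exists_uAtlas_range hA x y
    exact ⟨_, f, hf, a, b, ha, hb, rfl⟩
  rw [chartDist, dif_pos h]
  obtain ⟨_, ⟨f, hf, rfl⟩, a, b, ha, hb, hl⟩ := h.choose_spec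
  obtain ⟨s, hs⟩ := UProd.mk_surjective (modelToUProd P F μ L a)
  obtain ⟨t, ht⟩ := UProd.mk_surjective (modelToUProd P F μ L b)
  rw [hl, ← ha, ← hb, uChart_of_modelToUProd_eq f hs.symm, uChart_of_modelToUProd_eq f ht.symm,
    modelDist_uProd, ← hs, ← ht, uDist, uDist, UProd.map₂_mk, UProd.map₂_mk]
  exact congrArg (UProd.mk μ) (funext fun i => ((hA i).chartDist_apply (hf i) _ _).symm)

/-- Transition maps pass to the ultraproduct. Convexity does because a convex set is cut out by at
most one half-space for each root, so that the set of roots involved is constant on a set of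
measure one. -/
theorem uAtlas_transition (hA : ∀ i, IsAffineBuilding B (A i))
    {f g : ∀ i, ModelSpace P F (L i) → X i} (hf : ∀ i, f i ∈ A i) (hg : ∀ i, g i ∈ A i)
    (hne : (Set.range (uChart μ f) ∩ Set.range (uChart μ g)).Nonempty) :
    IsConvex (uChart μ f ⁻¹' Set.range (uChart μ g)) ∧
      ∃ w : AffineWeyl P F (UProd μ L), ∀ x ∈ uChart μ f ⁻¹' Set.range (uChart μ g),
        uChart μ f x = uChart μ g (w.act x) := by
  have : ∀ i, Nonempty (X i) := fun i => ⟨f i 0⟩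
  rw [range_uChart B, range_uChart B, UProd.set_inter_set, UProd.set_nonempty] at hne
  have hpre : uChart μ f ⁻¹' Set.range (uChart μ g) =
      modelToUProd P F μ L ⁻¹' UProd.set fun i => f i ⁻¹' Set.range (g i) := by
    ext x
    obtain ⟨s, hs⟩ := UProd.mk_surjective (modelToUProd P F μ L x)
    rw [range_uChart B, Set.mem_preimage, Set.mem_preimage, uChart_of_modelToUProd_eq f hs.symm,
      ← hs, UProd.mk_mem_set, UProd.mk_mem_set]
    rfl
  have h : ∀ i, ∃ (J : Set ι) (c : ι → L i) (w : AffineWeyl P F (L i)),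
      (Set.range (f i) ∩ Set.range (g i)).Nonempty →
        f i ⁻¹' Set.range (g i) = ⋂ j ∈ J, halfSpace j (c j) ∧
          ∀ x ∈ f i ⁻¹' Set.range (g i), f i x = g i (w.act x) := fun i => by
    by_cases hi : (Set.range (f i) ∩ Set.range (g i)).Nonempty
    · obtain ⟨hc, w, hw⟩ := (hA i).A2 _ (hf i) _ (hg i) hi
      obtain ⟨J, c, hJ⟩ := isConvex_iff.1 hc
      exact ⟨J, c, w, fun _ => ⟨hJ, hw⟩⟩
    · exact ⟨∅, 0, 1, fun h => absurd h hi⟩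
  choose J c w hw using h
  constructor
  · obtain ⟨J₀, hJ₀⟩ := UProd.exists_eventually_eq_const (μ := μ) J
    refine isConvex_iff.2 ⟨J₀, fun j => UProd.mk μ fun i => c i j, ?_⟩
    rw [biInter_halfSpace_uProd J₀ fun j i => c i j, hpre]
    congr 1
    refine UProd.set_eq_set.2 ?_
    filter_upwards [hJ₀, hne] with i hi hi'
    rw [← hi, (hw i hi').1]
  · obtain ⟨v, hv⟩ := (affineWeylToUProd_bijective B).2 (UProd.mk μ w)
    refine ⟨v, fun x hx => ?_⟩
    rw [hpre] at hx
    obtain ⟨s, hs⟩ := UProd.mk_surjective (modelToUProd P F μ L x)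
    rw [Set.mem_preimage, ← hs, UProd.mk_mem_set] at hx
    rw [← Function.comp_apply (f := uChart μ g), uChart_comp_act g hv,
      uChart_of_modelToUProd_eq _ hs.symm, uChart_of_modelToUProd_eq _ hs.symm, UProd.mk_eq_mk]
    filter_upwards [hne, hx] with i hi hxi using (hw i hi).2 _ hxi

theorem exists_uAtlas_retraction (hA : ∀ i, IsAffineBuilding B (A i))
    {f : ∀ i, ModelSpace P F (L i) → X i} (hf : ∀ i, f i ∈ A i)
    {x : UProd μ X} (hx : x ∈ Set.range (uChart μ f)) :
    ∃ r : UProd μ X → UProd μ X, (∀ y, r y ∈ Set.range (uChart μ f)) ∧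
      (∀ y ∈ Set.range (uChart μ f), r y = y) ∧
      (∀ y z, chartDist B (uAtlas μ A) (r y) (r z) ≤ chartDist B (uAtlas μ A) y z) ∧
      r ⁻¹' {x} = {x} := by
  obtain ⟨a, rfl⟩ := hx
  obtain ⟨s, hs⟩ := UProd.mk_surjective (modelToUProd P F μ L a)
  -- the representative `f i (s i)` of the centre lies in the apartment for every `i`
  choose r hr hfix hle hinv using fun i => (hA i).A5 (f i) (hf i) (f i (s i)) ⟨s i, rfl⟩
  refine ⟨UProd.map r, fun y => ?_, fun y hy => ?_, fun y z => ?_, ?_⟩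
  · obtain ⟨y, rfl⟩ := UProd.mk_surjective y
    rw [range_uChart B, UProd.map_mk, UProd.mk_mem_set]
    exact Filter.Eventually.of_forall fun i => hr i (y i)
  · obtain ⟨y, rfl⟩ := UProd.mk_surjective y
    rw [range_uChart B, UProd.mk_mem_set] at hy
    rw [UProd.map_mk, UProd.mk_eq_mk]
    exact hy.mono fun i hi => hfix i _ hi
  · obtain ⟨y, rfl⟩ := UProd.mk_surjective y
    obtain ⟨z, rfl⟩ := UProd.mk_surjective z
    rw [chartDist_uAtlas hA]
    exact Filter.Eventually.of_forall fun i => hle i (y i) (z i)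
  · ext y
    obtain ⟨y, rfl⟩ := UProd.mk_surjective y
    rw [uChart_of_modelToUProd_eq f hs.symm, Set.mem_preimage, Set.mem_singleton_iff,
      Set.mem_singleton_iff, UProd.map_mk, UProd.mk_eq_mk, UProd.mk_eq_mk]
    exact Filter.eventually_congr (Filter.Eventually.of_forall fun i =>
      Set.ext_iff.1 (hinv i) (y i))

theorem isAffineBuilding_uAtlas (hA : ∀ i, IsAffineBuilding B (A i)) :
    IsAffineBuilding B (uAtlas μ A) where
  injective := by
    rintro _ ⟨f, hf, rfl⟩
    exact uChart_injective B fun i => (hA i).injective _ (hf i)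
  A1 := by
    rintro _ ⟨f, hf, rfl⟩ w
    obtain ⟨v, hv⟩ := UProd.mk_surjective (affineWeylToUProd P F μ L w)
    exact ⟨_, fun i => (hA i).A1 _ (hf i) (v i), uChart_comp_act f hv.symm⟩
  A2 := by
    rintro _ ⟨f, hf, rfl⟩ _ ⟨g, hg, rfl⟩ hne
    exact uAtlas_transition hA hf hg hne
  A3 := exists_uAtlas_range hA
  A4 := by
    intro S₁ S₂ h₁ h₂
    obtain ⟨S₁, hS₁, rfl⟩ := isWeylChamberIn_uAtlas.1 h₁
    obtain ⟨S₂, hS₂, rfl⟩ := isWeylChamberIn_uAtlas.1 h₂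
    choose T₁ T₂ hT₁ hT₂ hle₁ hle₂ f hf hfT using fun i => (hA i).A4 _ _ (hS₁ i) (hS₂ i)
    have : ∀ i, Nonempty (X i) := fun i => ⟨f i 0⟩
    refine ⟨UProd.set T₁, UProd.set T₂, isWeylChamberIn_uAtlas.2 ⟨T₁, hT₁, rfl⟩,
      isWeylChamberIn_uAtlas.2 ⟨T₂, hT₂, rfl⟩,
      UProd.set_subset_set.2 (Filter.Eventually.of_forall hle₁),
      UProd.set_subset_set.2 (Filter.Eventually.of_forall hle₂), _, ⟨f, hf, rfl⟩, ?_⟩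
    rw [range_uChart B]
    exact Set.union_subset
      (UProd.set_subset_set.2 (Filter.Eventually.of_forall fun i =>
        Set.subset_union_left.trans (hfT i)))
      (UProd.set_subset_set.2 (Filter.Eventually.of_forall fun i =>
        Set.subset_union_right.trans (hfT i)))
  A5 := by
    rintro _ ⟨f, hf, rfl⟩ x hx
    exact exists_uAtlas_retraction hA hf hx
  A6 := by
    rintro _ ⟨f, hf, rfl⟩ _ ⟨g, hg, rfl⟩ _ ⟨h, hh, rfl⟩ h₁ h₂ h₃
    have : ∀ i, Nonempty (X i) := fun i => ⟨f i 0⟩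
    rw [range_uChart B, range_uChart B, UProd.set_inter_set] at h₁ h₂ h₃
    obtain ⟨T₁, hT₁, he₁⟩ := h₁.exists_eq_uProd_set B
    obtain ⟨T₂, hT₂, he₂⟩ := h₂.exists_eq_uProd_set B
    obtain ⟨T₃, hT₃, he₃⟩ := h₃.exists_eq_uProd_set B
    rw [range_uChart B, range_uChart B, range_uChart B, UProd.set_inter_set, UProd.set_inter_set,
      UProd.set_nonempty]
    filter_upwards [UProd.set_eq_set.1 he₁, UProd.set_eq_set.1 he₂, UProd.set_eq_set.1 he₃]
      with i hi₁ hi₂ hi₃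
    exact (hA i).A6 _ (hf i) _ (hg i) _ (hh i) (hi₁ ▸ hT₁ i) (hi₂ ▸ hT₂ i) (hi₃ ▸ hT₃ i)

end Ordered

end

end LambdaBuilding

theorem mainTheorem6 {ι V N : Type*} [Fintype ι] [AddCommGroup V] [Module ℝ V]
    [AddCommGroup N] [Module ℝ N] (P : RootPairing ι ℝ V N) [P.IsRootSystem]
    (F : Subfield ℝ) [P.IsValuedIn F] (B : SimpleRoots P)
    {I : Type*} (μ : Ultrafilter I)
    (L : I → Type*) [∀ i, AddCommGroup (L i)] [∀ i, LinearOrder (L i)]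
    [∀ i, IsOrderedAddMonoid (L i)] [∀ i, Nontrivial (L i)] [∀ i, Module F (L i)]
    (X : I → Type*) (A : ∀ i, Set (ModelSpace P F (L i) → X i))
    (hA : ∀ i, IsAffineBuilding B (A i)) :
    -- the canonical map identifies the model space with the ultraproduct of the model spaces
    Function.Bijective (modelToUProd P F μ L) ∧
    -- the ultraproduct is a generalized affine building
    IsAffineBuilding B (uAtlas μ A) ∧
    -- its distance is the ultraproduct of the distances, and is a metric
    chartDist B (uAtlas μ A) = uDist μ (fun i => chartDist B (A i)) ∧
    IsLambdaMetric (uDist μ (fun i => chartDist B (A i))) ∧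
    -- more generally the ultraproduct of arbitrary metrics is a metric
    (∀ d : ∀ i, X i → X i → L i, (∀ i, IsLambdaMetric (d i)) → IsLambdaMetric (uDist μ d)) ∧
    -- the ultraproduct of the affine Weyl groups is the full affine Weyl group of the model space,
    -- compatibly with the actions
    (∃ Φ : UProd μ (fun i => AffineWeyl P F (L i)) ≃* AffineWeyl P F (UProd μ L),
      (∀ (u : P.weylGroup) (s : ∀ i, ModelSpace P F (L i)) (t : ModelSpace P F (UProd μ L)),
        modelToUProd P F μ L t = UProd.mk μ s →
          Φ (UProd.mk μ fun i => AffineWeyl.mk' (s i) u) = AffineWeyl.mk' t u) ∧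
      ∀ (w : ∀ i, AffineWeyl P F (L i)) (s : ∀ i, ModelSpace P F (L i))
        (t : ModelSpace P F (UProd μ L)), modelToUProd P F μ L t = UProd.mk μ s →
          modelToUProd P F μ L ((Φ (UProd.mk μ w)).act t) =
            UProd.mk μ fun i => (w i).act (s i)) ∧
    -- in coordinates, it is `W_s ⋉ (∏_μ Λᵢ)ⁿ` with `n` the rank of the root system
    B.support.card = Module.finrank ℝ V ∧
    ∃ Ψ : UProd μ (fun i => AffineWeyl P F (L i)) ≃* CoordAffineWeyl P F (UProd μ L) B,
      ∀ (u : P.weylGroup) (s : ∀ i, ModelSpace P F (L i)),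
        Ψ (UProd.mk μ fun i => AffineWeyl.mk' (s i) u) =
          ⟨Multiplicative.ofAdd fun b => UProd.mk μ fun i => coords P F (L i) B (s i) b, u⟩ := by
  have hbij := modelToUProd_bijective F μ L B
  have hΦ := affineWeylToUProd_bijective (F := F) (μ := μ) (L := L) B
  have hmk : ∀ (u : P.weylGroup) (s : ∀ i, ModelSpace P F (L i)) (t : ModelSpace P F (UProd μ L)),
      modelToUProd P F μ L t = UProd.mk μ s →
        (MulEquiv.ofBijective _ hΦ).symm (UProd.mk μ fun i => AffineWeyl.mk' (s i) u) =
          AffineWeyl.mk' t u := fun u s t h => by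
    rw [MulEquiv.symm_apply_eq, MulEquiv.ofBijective_apply, affineWeylToUProd_mk' u h]
  refine ⟨hbij, isAffineBuilding_uAtlas hA, chartDist_uAtlas hA,
    IsLambdaMetric.uDist μ fun i => (hA i).isLambdaMetric_chartDist,
    fun d hd => IsLambdaMetric.uDist μ hd,
    ⟨(MulEquiv.ofBijective _ hΦ).symm, hmk, fun w s t h => ?_⟩, B.card_support,
    (MulEquiv.ofBijective _ hΦ).symm.trans (semidirectCongr _ _ _ (weylCoords_coords B)), fun u s => ?_⟩
  · rw [modelToUProd_act, ← MulEquiv.ofBijective_apply _ hΦ, MulEquiv.apply_symm_apply, h,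
      UProd.map₂_mk]
  · obtain ⟨t, ht⟩ := hbij.2 (UProd.mk μ s)
    rw [MulEquiv.trans_apply, hmk u s t ht]
    refine SemidirectProduct.ext (congrArg Multiplicative.ofAdd (funext fun b => ?_)) rfl
    refine (coords_uProd B b t).trans ?_
    rw [ht, UProd.map_mk]
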